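/- **Theorem 2.2.** Let $t\ge 0$ and let $r_1,\dots,r_t\ge 0$ be integers. Let $F$ be the free group on $x_1,\dots,x_t$, let $H_i=\mathbb Z_{r_i}=\mathbb Z/r_i\mathbb Z$ (so $H_i=\mathbb Z$ if $r_i=0$), and let $S$ be the normal closure of $x_1^{r_1},\dots,x_t^{r_t}$ in $F$. Write $\gamma_m(F)$ for the terms of the lower central series ($\gamma_1(F)=F$, $\gamma_{m+1}(F)=[\gamma_m(F),F]$), and put $\rho_1(S)=S$, $\rho_{m+1}(S)=[\rho_m(S),F]$, so that $\rho_{m+1}(S)=[S,\,{}_mF]$. Basic commutators are the following bracketed words in the letters $x_1,\dots,x_t$, where the weight of a word is its number of letters. Fix a strict total order on bracketed words such that words of smaller weight come first and $x_i<x_j$ whenever $i<j$ (it is otherwise arbitrary within each weight). Each letter is basic; a word $[u,v]$ is basic if and only if $u$ and $v$ are basic, $u>v$, and moreover $b\le v$ whenever $u=[a,b]$. For a bracketed word $w$ define an abelian group $H_w$ and an element $\tau_w\in H_w$ recursively by $H_{x_i}=H_i$, $\tau_{x_i}=1\in\mathbb Z/r_i\mathbb Z$, and $H_{[u,v]}=H_u\otimes_{\mathbb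 Z}H_v$, $\tau_{[u,v]}=\tau_u\otimes\tau_v$. Let $$T(H_1,\dots,H_t)_{s}=\bigoplus_{w}H_w ,$$ the sum being over all basic commutators $w$ of weight $s$. Then, for every $c\ge 1$ and every such order, there is an isomorphism of groups $$\frac{\gamma_{c+1}(F)}{\rho_{c+1}(S)\,\gamma_{c+2}(F)}\;\cong\;T(H_1,\dots,H_t)_{c+1}$$ which, for each basic commutator $w$ of weight $c+1$, sends the class of the element of $F$ obtained by evaluating $w$ (which lies in $\gamma_{c+1}(F)$) to the elementary tensor $\tau_w$ in the summand $H_w$. -/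

import Mathlib

open scoped TensorProduct commutatorElement

namespace BasicComm

/-- `iterComm S n` is the left-normed commutator subgroup `[S, F, ..., F]` with `n` copies of the
whole group `F`. So `ρ_{m+1}(S) = [S, _m F]` is `iterComm S m`. -/
def iterComm {F : Type*} [Group F] (S : Subgroup F) : ℕ → Subgroup F
  | 0 => S
  | n + 1 => ⁅iterComm S n, (⊤ : Subgroup F)⁆

instance iterComm_normal {F : Type*} [Group F] (S : Subgroup F) [hS : S.Normal] (n : ℕ) :
    (iterComm S n).Normal := by
  induction n with
  | zero => exact hS
  | succ n ih =>
    have := ih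
    exact Subgroup.commutator_normal _ _

/-- The subgroup `S`: the normal closure in the free group on `x_1, ..., x_t` of the elements
`x_i ^ r_i`. -/
def powClosure {t : ℕ} (r : Fin t → ℕ) : Subgroup (FreeGroup (Fin t)) :=
  Subgroup.normalClosure (Set.range fun i => FreeGroup.of i ^ r i)

instance powClosure_normal {t : ℕ} (r : Fin t → ℕ) : (powClosure r).Normal :=
  Subgroup.normalClosure_normal

/-- The group `γ_{c+1}(F) / (ρ_{c+1}(S) γ_{c+2}(F))`. Mathlib's lower central series starts at
index `0`, so `γ_{c+1}(F)` is `(⊤ : Subgroup F).lowerCentralSeries c`. -/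
abbrev LCSQuotient {t : ℕ} (r : Fin t → ℕ) (c : ℕ) : Type :=
  ↥((⊤ : Subgroup (FreeGroup (Fin t))).lowerCentralSeries c) ⧸
    (iterComm (powClosure r) c ⊔
      (⊤ : Subgroup (FreeGroup (Fin t))).lowerCentralSeries (c + 1)).subgroupOf
        ((⊤ : Subgroup (FreeGroup (Fin t))).lowerCentralSeries c)

/-- The formal bracketed words on the letters `x_1, ..., x_t`; the product `u * v` stands for the
formal commutator `[u, v]`, and `FreeMagma.length` is the weight. -/
abbrev BracketWord (t : ℕ) : Type := FreeMagma (Fin t)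

/-- The orderings admitted in the definition of basic commutators: strict total orders in which
smaller weight comes first and `x_1 < ... < x_t`; the order within a given weight `≥ 2` is
arbitrary. -/
structure IsCommutatorOrder {t : ℕ} (lt : BracketWord t → BracketWord t → Prop) : Prop where
  irrefl : ∀ u, ¬ lt u u
  trans : ∀ u v w, lt u v → lt v w → lt u w
  total : ∀ u v, lt u v ∨ u = v ∨ lt v u
  weight : ∀ u v, u.length < v.length → lt u v
  letters : ∀ i j : Fin t, i < j → lt (FreeMagma.of i) (FreeMagma.of j)

/-- Orderings as above exist for every number of letters. -/
theorem exists_isCommutatorOrder (t : ℕ) :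
    ∃ lt : BracketWord t → BracketWord t → Prop, IsCommutatorOrder lt := by
  let f : BracketWord t → (ℕ ×ₗ ℕ) := fun u =>
    toLex (u.length, FreeMagma.recOnMul u (fun i => (i : ℕ)) (fun _ _ _ _ => 0))
  let s : BracketWord t → BracketWord t → Prop := WellOrderingRel
  refine ⟨fun u v => f u < f v ∨ f u = f v ∧ s u v, ?_, ?_, ?_, ?_, ?_⟩
  · rintro u (h | ⟨_, h⟩)
    · exact lt_irrefl _ h
    · exact irrefl_of s u h
  · rintro u v w (h | ⟨h, h'⟩) (k | ⟨k, k'⟩)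
    · exact Or.inl (h.trans k)
    · exact Or.inl (k ▸ h)
    · exact Or.inl (h ▸ k)
    · exact Or.inr ⟨h.trans k, trans_of s h' k'⟩
  · intro u v
    rcases lt_trichotomy (f u) (f v) with h | h | h
    · exact Or.inl (Or.inl h)
    · rcases trichotomous_of s u v with k | k | k
      · exact Or.inl (Or.inr ⟨h, k⟩)
      · exact Or.inr (Or.inl k)
      · exact Or.inr (Or.inr (Or.inr ⟨h.symm, k⟩))
    · exact Or.inr (Or.inr (Or.inl h))
  · intro u v h
    exact Or.inl (Prod.Lex.toLex_lt_toLex.mpr (Or.inl h))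
  · intro i j h
    exact Or.inl (Prod.Lex.toLex_lt_toLex.mpr (Or.inr ⟨rfl, h⟩))

/-- Basic commutators (P. Hall, M. Hall), as bracketed words: each letter is basic, and `[u, v]`
is basic iff `u`, `v` are basic, `u > v`, and `b ≤ v` whenever `u = [a, b]`. -/
def IsBasic {t : ℕ} (lt : BracketWord t → BracketWord t → Prop) : BracketWord t → Prop
  | .of _ => True
  | .mul u v => IsBasic lt u ∧ IsBasic lt v ∧ lt v u ∧
      ∀ a b : BracketWord t, u = a * b → b = v ∨ lt b v

/-- The element of the free group obtained by evaluating a bracketed word. -/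
def eval {t : ℕ} : BracketWord t → FreeGroup (Fin t)
  | .of i => FreeGroup.of i
  | .mul u v => ⁅eval u, eval v⁆

/-- The tensor product over `ℤ` of the groups `H_i = ℤ / r_i`, taken along a bracketed word:
`x_i` gives `H_i` and `[u, v]` gives the tensor product of the groups of `u` and `v`. -/
noncomputable def tensorGroup {t : ℕ} (r : Fin t → ℕ) : BracketWord t → ModuleCat.{0} ℤ
  | .of i => ModuleCat.of ℤ (ZMod (r i))
  | .mul u v => ModuleCat.of ℤ (tensorGroup r u ⊗[ℤ] tensorGroup r v)

/-- The elementary tensor of a bracketed word, whose entries are the generators `π_i x_i = 1` of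
`H_i = ℤ / r_i`. -/
noncomputable def elemTensor {t : ℕ} (r : Fin t → ℕ) : (w : BracketWord t) → tensorGroup r w
  | .of i => (1 : ZMod (r i))
  | .mul u v => elemTensor r u ⊗ₜ[ℤ] elemTensor r v

/-- The basic commutators of weight `s` on `t` letters. -/
abbrev BasicOfWeight {t : ℕ} (lt : BracketWord t → BracketWord t → Prop) (s : ℕ) : Type :=
  {w : BracketWord t // IsBasic lt w ∧ w.length = s}

/-- `T(H_1, ..., H_t)_s`: the direct sum, over all basic commutators of weight `s`, of the
corresponding tensor products. -/
abbrev T {t : ℕ} (r : Fin t → ℕ) (lt : BracketWord t → BracketWord t → Prop) (s : ℕ) : Type :=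
  DirectSum (BasicOfWeight lt s) fun w => tensorGroup r w.1

end BasicComm

/-! Each $H_w$ is cyclic, generated by $\tau_w$, of order $d_w=\gcd\{r_i : x_i \text{ occurs in }
w\}$ (infinite if $d_w=0$). Powers pass through commutators modulo higher weight, so the class of
$w$ is killed by each $r_i$ with $x_i$ in $w$ (`eval_pow_mem`), hence by $d_w$. This gives a
homomorphism from the direct sum to the quotient with $\tau_w\mapsto[w]$; the isomorphism sought is
its inverse.

Surjectivity is Hall's rewriting (`weightLCS_succ_eq_basicSubgroup`): basic commutators of weight
$n$ generate $\gamma_n(F)$ modulo $\gamma_{n+1}(F)$.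

For injectivity, let $\prod_w [w]^{n_w}=1$ and fix $w_0$, with $d=d_{w_0}$. Over $\mathbb Z/d$ the
Magnus map sends $x_i$ to $1+a_iX$, where $a_i$ is a free variable if $x_i$ occurs in $w_0$ and $0$
otherwise. Then $r_ia_i=0$ for all $i$, so $S$ becomes trivial modulo $X^2$, and $\rho_{c+1}(S)$ and
$\gamma_{c+2}(F)$ become trivial modulo $X^{c+2}$. The coefficient of $X^{c+1}$ turns the relation
into a linear relation among Lie values of basic commutators. These are independent over any
commutative ring (`linearIndependent_lieEval`, by Lazard elimination), so $d\mid n_{w_0}$. -/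

/-! ### Lazard elimination in free algebras. -/

section FreeAlgebraElimination

variable (R : Type*) [CommRing R]

/-- The derivation of the free algebra on `I × ℕ` which sends the letter `(i, k)` to
`(i, k + 1)`, as a linear map. -/
noncomputable def FreeAlgebra.shiftDerivation (I : Type*) :
    FreeAlgebra R (I × ℕ) →ₗ[R] FreeAlgebra R (I × ℕ) :=
  (TrivSqZeroExt.sndHom (FreeAlgebra R (I × ℕ)) (FreeAlgebra R (I × ℕ))).restrictScalars R ∘ₗ
    (FreeAlgebra.lift R (A := TrivSqZeroExt (FreeAlgebra R (I × ℕ)) (FreeAlgebra R (I × ℕ)))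
      fun p => TrivSqZeroExt.inl (FreeAlgebra.ι R p) +
        TrivSqZeroExt.inr (FreeAlgebra.ι R (p.1, p.2 + 1))).toLinearMap

theorem FreeAlgebra.shiftDerivation_ι_mul {I : Type*} (p : I × ℕ) (a : FreeAlgebra R (I × ℕ)) :
    shiftDerivation R I (ι R p * a) =
      ι R (p.1, p.2 + 1) * a + ι R p * shiftDerivation R I a := by
  -- The first component is the identity, so multiplicativity of the lift is the Leibniz rule for
  -- its second component.
  have key : ∀ b : FreeAlgebra R (I × ℕ), TrivSqZeroExt.fst (FreeAlgebra.lift R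
      (A := TrivSqZeroExt (FreeAlgebra R (I × ℕ)) (FreeAlgebra R (I × ℕ)))
      (fun p => TrivSqZeroExt.inl (FreeAlgebra.ι R p) +
        TrivSqZeroExt.inr (FreeAlgebra.ι R (p.1, p.2 + 1))) b) = b := by
    intro b
    have : (TrivSqZeroExt.fstHom R (FreeAlgebra R (I × ℕ)) (FreeAlgebra R (I × ℕ))).comp
        (FreeAlgebra.lift R
          (A := TrivSqZeroExt (FreeAlgebra R (I × ℕ)) (FreeAlgebra R (I × ℕ)))
          (fun p => TrivSqZeroExt.inl (FreeAlgebra.ι R p) +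
            TrivSqZeroExt.inr (FreeAlgebra.ι R (p.1, p.2 + 1)))) = AlgHom.id R _ := by
      ext q
      simp
    exact DFunLike.congr_fun this b
  simp only [shiftDerivation, LinearMap.comp_apply, AlgHom.toLinearMap_apply, map_mul,
    LinearMap.restrictScalars_apply, TrivSqZeroExt.sndHom_apply, TrivSqZeroExt.snd_mul,
    FreeAlgebra.lift_ι_apply, key]
  simp [add_comm]

/-- Elimination of one letter: if the `y i` generate a free algebra, then so do the iterated
brackets `[y i, y i₀, ..., y i₀]` with `i ≠ i₀`. -/
theorem FreeAlgebra.lift_iterate_lie_injective {I J A : Type*} [Ring A] [Algebra R A] {y : I → A}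
    (hy : Function.Injective (FreeAlgebra.lift R y)) (i₀ : I) (g : J → I × ℕ)
    (hg : Function.Injective g) (hg₀ : ∀ j, (g j).1 ≠ i₀) :
    Function.Injective
      (FreeAlgebra.lift R fun j => (fun a => ⁅a, y i₀⁆)^[(g j).2] (y (g j).1)) := by
  classical
  -- With $D$ the shift derivation and $L_p$ left multiplication, $[L_p,-D]=L_{D(p)}$. Hence
  -- bracketing $k$ times with the letter `i₀` turns $L_{(i,0)}$ into $L_{(i,k)}$.
  let act : I → Module.End R (FreeAlgebra R (I × ℕ)) := fun i =>
    if i = i₀ then -shiftDerivation R I else LinearMap.mulLeft R (ι R (i, 0))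
  let θ := FreeAlgebra.lift R act
  have hθ : ∀ i, i ≠ i₀ → ∀ k : ℕ,
      θ ((fun a => ⁅a, ι R i₀⁆)^[k] (ι R i)) = LinearMap.mulLeft R (ι R (i, k)) := by
    intro i hi k
    induction k with
    | zero => simp [θ, act, hi]
    | succ k ih =>
      rw [Function.iterate_succ_apply', Ring.lie_def, map_sub, map_mul, map_mul, ih]
      ext1 a
      simp [θ, act, Module.End.mul_apply, shiftDerivation_ι_mul]
  let φ : FreeAlgebra R J →ₐ[R] FreeAlgebra R I :=
    FreeAlgebra.lift R fun j => (fun a => ⁅a, ι R i₀⁆)^[(g j).2] (ι R (g j).1)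
  have hφ : (FreeAlgebra.lift R fun j => (fun a => ⁅a, y i₀⁆)^[(g j).2] (y (g j).1)) =
      (FreeAlgebra.lift R y).comp φ := by
    ext j
    simp only [φ, Function.comp_apply, lift_ι_apply, AlgHom.coe_comp]
    have : ∀ k : ℕ, FreeAlgebra.lift R y ((fun a => ⁅a, ι R i₀⁆)^[k] (ι R (g j).1)) =
        (fun a => ⁅a, y i₀⁆)^[k] (y (g j).1) := by
      intro k
      induction k with
      | zero => simp
      | succ k ih =>
        rw [Function.iterate_succ_apply', Function.iterate_succ_apply', Ring.lie_def, Ring.lie_def,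
          map_sub, map_mul, map_mul, ih, lift_ι_apply]
    exact (this _).symm
  rw [hφ, AlgHom.coe_comp]
  refine hy.comp ?_
  -- Evaluating the action at `1` gives the word in the letters `g j`; renaming `g j` to `j` then
  -- yields a left inverse of `φ`. Letters outside the range of `g` do not occur, so their image is
  -- arbitrary.
  let back : FreeAlgebra R (I × ℕ) →ₐ[R] FreeAlgebra R J :=
    FreeAlgebra.lift R fun p => if h : ∃ j, g j = p then ι R h.choose else 0
  have hb : ∀ a, back (θ (φ a) 1) = a := by
    have h1 : θ.comp φ = (Algebra.lmul R (FreeAlgebra R (I × ℕ))).comp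
        (FreeAlgebra.lift R fun j => ι R (g j)) := by
      ext1
      funext j
      simp only [φ, Function.comp_apply, lift_ι_apply, AlgHom.coe_comp, hθ _ (hg₀ j)]
      rfl
    have h2 : back.comp (FreeAlgebra.lift R fun j => ι R (g j)) = AlgHom.id R _ := by
      ext j
      have hex : ∃ j', g j' = g j := ⟨j, rfl⟩
      simp only [back, Function.comp_apply, lift_ι_apply, AlgHom.coe_comp, dif_pos hex,
        AlgHom.coe_id, id_eq]
      rw [hg hex.choose_spec]
    intro a
    have h3 := DFunLike.congr_fun h1 a
    simp only [AlgHom.comp_apply] at h3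
    rw [h3]
    simpa using DFunLike.congr_fun h2 a
  exact Function.LeftInverse.injective (g := fun b => back (θ b 1)) hb

theorem FreeAlgebra.linearIndependent_of_lift_injective {I A : Type*} [Ring A] [Algebra R A]
    {y : I → A} (hy : Function.Injective (FreeAlgebra.lift R y)) : LinearIndependent R y := by
  classical
  have hι : LinearIndependent R (ι R : I → FreeAlgebra R I) := by
    rw [linearIndependent_iff']
    intro s f hf i hi
    -- Sending the letter `i` to $\varepsilon$ and the others to $0$ in the dual numbers reads off
    -- the coefficient of `i`.
    have h := congrArg (fun a => TrivSqZeroExt.snd (FreeAlgebra.lift R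
      (A := TrivSqZeroExt R R) (fun j => if j = i then TrivSqZeroExt.inr 1 else 0) a)) hf
    simp only [map_sum, map_smul, lift_ι_apply, smul_ite, smul_zero, map_zero] at h
    rw [Finset.sum_ite_eq' s i, if_pos hi] at h
    simpa using h
  have := hι.map' (FreeAlgebra.lift R y).toLinearMap (LinearMap.ker_eq_bot.mpr hy)
  have h : ⇑(FreeAlgebra.lift R y).toLinearMap ∘ ι R = y := FreeAlgebra.ι_comp_lift y
  rwa [h] at this

end FreeAlgebraElimination

/-! ### Basic commutators as free generators. -/

namespace BasicComm

/-- The value of a bracketed word in a ring, brackets being read as Lie brackets. -/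
def lieEval {t : ℕ} {A : Type*} [Ring A] (x : Fin t → A) : BracketWord t → A
  | .of i => x i
  | .mul u v => ⁅lieEval x u, lieEval x v⁆

theorem finite_length_le (t n : ℕ) : {w : BracketWord t | w.length ≤ n}.Finite := by
  induction n with
  | zero =>
    refine Set.Finite.subset Set.finite_empty fun w hw => ?_
    have := w.length_pos
    simp only [Set.mem_ofPred_eq] at hw
    omega
  | succ n ih =>
    refine ((Set.finite_range (FreeMagma.of : Fin t → BracketWord t)).union
      (ih.image2 (fun u v => u * v) ih)).subset fun w hw => ?_
    cases w with
    | of i => exact Or.inl ⟨i, rfl⟩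
    | mul u v =>
      have hu := u.length_pos
      have hv := v.length_pos
      have : u.length + v.length ≤ n + 1 := hw
      exact Or.inr ⟨u, by simp only [Set.mem_ofPred_eq]; omega, v,
        by simp only [Set.mem_ofPred_eq]; omega, rfl⟩

section Order

variable {t : ℕ} {lt : BracketWord t → BracketWord t → Prop}

theorem IsCommutatorOrder.isStrictTotalOrder (hlt : IsCommutatorOrder lt) :
    IsStrictTotalOrder (BracketWord t) lt where
  irrefl := hlt.irrefl
  trans := hlt.trans
  trichotomous u v h1 h2 := by
    rcases hlt.total u v with h | h | h
    · exact absurd h h1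
    · exact h
    · exact absurd h h2

/-- The basic commutators that are not in `E` but whose right factor, if any, is in `E`. When `E`
is an initial segment of the basic commutators, these are the free generators left after the
elements of `E` have been eliminated. -/
abbrev Remaining (lt : BracketWord t → BracketWord t → Prop) (E : Finset (BracketWord t)) : Type :=
  {w : BracketWord t // IsBasic lt w ∧ w ∉ E ∧ ∀ a b, w = a * b → b ∈ E}

theorem mul_ne_of {u v : BracketWord t} {i : Fin t} : (FreeMagma.of i : BracketWord t) ≠ u * v := by
  intro h
  change FreeMagma.of i = FreeMagma.mul u v at h
  cases h

theorem mul_inj {a b c d : BracketWord t} (h : a * b = c * d) : a = c ∧ b = d := by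
  change FreeMagma.mul a b = FreeMagma.mul c d at h
  cases h
  exact ⟨rfl, rfl⟩

/-- Right factors `c` are peeled off one at a time. If `[[p, q], c]` is basic then `q ≤ c`, so the
next right factor is again `c` or lies in `E`, where peeling stops. -/
theorem exists_eliminated (hlt : IsCommutatorOrder lt) {c : BracketWord t}
    {E : Finset (BracketWord t)} (hE : ∀ w, IsBasic lt w → (w ∈ E ↔ lt w c))
    (w : BracketWord t) (hw : IsBasic lt w) (hwc : w ≠ c) (hwE : w ∉ E)
    (hf : ∀ a b, w = a * b → b ∈ E ∨ b = c) :
    ∃ (y : Remaining lt E) (k : ℕ), y.1 ≠ c ∧ w = (fun a => a * c)^[k] y.1 := by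
  induction w with
  | of i => exact ⟨⟨.of i, hw, hwE, fun a b h => absurd h mul_ne_of⟩, 0, hwc, rfl⟩
  | mul a b iha ihb =>
    rcases hf a b rfl with hb | rfl
    · refine ⟨⟨.mul a b, hw, hwE, fun a' b' h => ?_⟩, 0, hwc, rfl⟩
      rw [← (mul_inj h).2]
      exact hb
    · obtain ⟨ha, hb, hba, hr⟩ := hw
      have hab : a ≠ b := fun h => hlt.irrefl _ (h ▸ hba)
      have haE : a ∉ E := fun h => hlt.irrefl _ (hlt.trans _ _ _ hba ((hE a ha).1 h))
      obtain ⟨y, k, hy, hk⟩ := iha ha hab haE fun p q h => by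
        rcases hr p q h with rfl | hq
        · exact Or.inr rfl
        · subst h
          exact Or.inl ((hE q ha.2.1).2 hq)
      refine ⟨y, k + 1, hy, ?_⟩
      rw [Function.iterate_succ_apply', ← hk]
      rfl

/-- Induction on `E`, adding its largest element `c`: each generator then remaining is `[y, c, ...,
c]` with `y ≠ c` remaining before, so elimination of `c` applies. For empty `E` the generators are
the letters. -/
theorem lift_lieEval_remaining_injective (R : Type*) [CommRing R] (hlt : IsCommutatorOrder lt)
    (E : Finset (BracketWord t)) (hE : ∀ w ∈ E, IsBasic lt w)
    (hE' : ∀ v ∈ E, ∀ w, IsBasic lt w → lt w v → w ∈ E) :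
    Function.Injective (FreeAlgebra.lift R
      fun w : Remaining lt E => lieEval (FreeAlgebra.ι R) w.1) := by
  classical
  have := hlt.isStrictTotalOrder
  let : LinearOrder (BracketWord t) := linearOrderOfSTO lt
  induction E using Finset.induction_on_max with
  | empty =>
    let back : FreeAlgebra R (Fin t) →ₐ[R] FreeAlgebra R (Remaining lt ∅) :=
      FreeAlgebra.lift R fun i => FreeAlgebra.ι R
        ⟨.of i, trivial, Finset.notMem_empty _, fun a b h => absurd h mul_ne_of⟩
    have : back.comp (FreeAlgebra.lift R
        fun w : Remaining lt ∅ => lieEval (FreeAlgebra.ι R) w.1) = AlgHom.id R _ := by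
      ext ⟨w, h1, h2, h3⟩
      cases w with
      | of i => simp [back, lieEval]
      | mul a b => exact absurd (h3 a b rfl) (Finset.notMem_empty _)
    exact Function.LeftInverse.injective (DFunLike.congr_fun this)
  | insert c E hc ih =>
    have hcE : c ∉ E := fun h => hlt.irrefl _ (hc c h)
    have hmem : ∀ w, IsBasic lt w → (w ∈ E ↔ lt w c) := fun w hw => by
      refine ⟨hc w, fun h => ?_⟩
      rcases Finset.mem_insert.1 (hE' c (Finset.mem_insert_self _ _) w hw h) with rfl | h'
      · exact absurd h (hlt.irrefl _)
      · exact h'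
    have hcb : IsBasic lt c := hE c (Finset.mem_insert_self _ _)
    have ih := ih (fun w hw => hE w (Finset.mem_insert_of_mem hw)) fun v hv w hw hwv =>
      (hmem w hw).2 (hlt.trans _ _ _ hwv (hc v hv))
    -- The right factor of `c` has smaller weight, so it precedes `c` and lies in `E`.
    let c' : Remaining lt E := ⟨c, hcb, hcE, fun a b h => by
      subst h
      refine (hmem b hcb.2.1).2 (hlt.weight _ _ ?_)
      have := a.length_pos
      change b.length < a.length + b.length
      omega⟩
    have hex : ∀ w : Remaining lt (insert c E), ∃ p : Remaining lt E × ℕ,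
        p.1 ≠ c' ∧ w.1 = (fun a => a * c)^[p.2] p.1.1 := by
      rintro ⟨w, h1, h2, h3⟩
      rw [Finset.mem_insert, not_or] at h2
      obtain ⟨y, k, hy, hk⟩ := exists_eliminated hlt hmem w h1 h2.1 h2.2 fun a b h =>
        (Finset.mem_insert.1 (h3 a b h)).symm
      exact ⟨(y, k), fun h => hy (congrArg Subtype.val h), hk⟩
    choose g hg hgw using hex
    have hgi : Function.Injective g := fun v w h => Subtype.ext <| by rw [hgw v, hgw w, h]
    convert FreeAlgebra.lift_iterate_lie_injective R ih c' g hgi hg using 4 with w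
    rw [hgw w]
    have : ∀ k : ℕ, lieEval (FreeAlgebra.ι R) ((fun a => a * c)^[k] (g w).1.1) =
        (fun a => ⁅a, lieEval (FreeAlgebra.ι R) c'.1⁆)^[k]
          (lieEval (FreeAlgebra.ι R) (g w).1.1) := by
      intro k
      induction k with
      | zero => rfl
      | succ k ih =>
        rw [Function.iterate_succ_apply', Function.iterate_succ_apply', ← ih]
        rfl
    exact this _

/-- The basic commutators of a given weight are linearly independent in the free algebra, over
every commutative ring. -/
theorem linearIndependent_lieEval (R : Type*) [CommRing R] (hlt : IsCommutatorOrder lt) (n : ℕ) :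
    LinearIndependent R
      fun w : BasicOfWeight lt n => lieEval (FreeAlgebra.ι R : Fin t → _) w.1 := by
  classical
  have hfin : {w : BracketWord t | IsBasic lt w ∧ w.length < n}.Finite :=
    (finite_length_le t n).subset fun w hw => hw.2.le
  let E := hfin.toFinset
  have hE : ∀ w, w ∈ E ↔ IsBasic lt w ∧ w.length < n := fun w => hfin.mem_toFinset
  have h := FreeAlgebra.linearIndependent_of_lift_injective R
    (lift_lieEval_remaining_injective R hlt E (fun w hw => ((hE w).1 hw).1)
      fun v hv w hw hwv => (hE w).2 ⟨hw, by
        have h1 := ((hE v).1 hv).2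
        by_contra h2
        exact hlt.irrefl _ (hlt.trans _ _ _ hwv (hlt.weight v w (by omega)))⟩)
  -- Once all basic commutators of weight below `n` are eliminated, those of weight `n` are among
  -- the free generators left.
  let f : BasicOfWeight lt n → Remaining lt E := fun w => ⟨w.1, w.2.1, fun h => by
    have := ((hE _).1 h).2
    have := w.2.2
    omega, fun a b hab => by
    obtain ⟨w, hw, hn⟩ := w
    subst hab
    refine (hE b).2 ⟨hw.2.1, ?_⟩
    have := a.length_pos
    change a.length + b.length = n at hn
    omega⟩
  exact h.comp f fun v w hvw => Subtype.ext (congrArg (fun x : Remaining lt E => x.1) hvw)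

end Order

/-! ### The Magnus homomorphism and its leading coefficients. -/

section Magnus

open PowerSeries

variable {A : Type*} [Ring A]

theorem X_pow_dvd_mul_left {n : ℕ} {φ : A⟦X⟧} (ψ : A⟦X⟧) (h : X ^ n ∣ φ) : X ^ n ∣ ψ * φ := by
  obtain ⟨a, rfl⟩ := h
  exact ⟨ψ * a, by rw [← mul_assoc, ← mul_assoc, X_pow_mul]⟩

/-- The units of `A⟦X⟧` that are congruent to `1` modulo `X ^ n`. -/
def congruenceUnits (A : Type*) [Ring A] (n : ℕ) : Subgroup A⟦X⟧ˣ where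
  carrier := {u | X ^ n ∣ (u : A⟦X⟧) - 1}
  one_mem' := by simp
  mul_mem' {u v} hu hv := by
    have : ((u * v : A⟦X⟧ˣ) : A⟦X⟧) - 1 = (u : A⟦X⟧) * (v - 1) + (u - 1) := by
      rw [Units.val_mul]
      noncomm_ring
    change (X ^ n : A⟦X⟧) ∣ ((u * v : A⟦X⟧ˣ) : A⟦X⟧) - 1
    rw [this]
    exact dvd_add (X_pow_dvd_mul_left _ hv) hu
  inv_mem' {u} hu := by
    have : ((u⁻¹ : A⟦X⟧ˣ) : A⟦X⟧) - 1 = -(((u⁻¹ : A⟦X⟧ˣ) : A⟦X⟧) * (u - 1)) := by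
      rw [mul_sub, Units.inv_mul]
      noncomm_ring
    change (X ^ n : A⟦X⟧) ∣ ((u⁻¹ : A⟦X⟧ˣ) : A⟦X⟧) - 1
    rw [this]
    exact (dvd_neg.2 (X_pow_dvd_mul_left _ hu))

theorem mem_congruenceUnits {n : ℕ} {u : A⟦X⟧ˣ} :
    u ∈ congruenceUnits A n ↔ X ^ n ∣ (u : A⟦X⟧) - 1 := Iff.rfl

theorem congruenceUnits_zero : congruenceUnits A 0 = ⊤ :=
  eq_top_iff.2 fun u _ => mem_congruenceUnits.2 (by simp)

theorem congruenceUnits_antitone : Antitone (congruenceUnits A) := fun _ _ h _ hu =>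
  (pow_dvd_pow X h).trans hu

/-- $[u,v]-1=(uv-vu)u^{-1}v^{-1}$, and $uv-vu$ is unchanged when $u$ and $v$ are replaced by $u-1$
and $v-1$. -/
theorem commutator_sub_one_eq {m n : ℕ} {u v : A⟦X⟧ˣ} {a b : A⟦X⟧}
    (hu : (u : A⟦X⟧) - 1 = X ^ m * a) (hv : (v : A⟦X⟧) - 1 = X ^ n * b) :
    ((⁅u, v⁆ : A⟦X⟧ˣ) : A⟦X⟧) - 1 =
      X ^ (m + n) * ((a * b - b * a) * ((u⁻¹ : A⟦X⟧ˣ) : A⟦X⟧) * ((v⁻¹ : A⟦X⟧ˣ) : A⟦X⟧)) := by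
  have h1 : (u : A⟦X⟧) * (v : A⟦X⟧) - (v : A⟦X⟧) * (u : A⟦X⟧) = X ^ (m + n) * (a * b - b * a) := by
    have : (u : A⟦X⟧) * (v : A⟦X⟧) - (v : A⟦X⟧) * (u : A⟦X⟧) =
        ((u : A⟦X⟧) - 1) * ((v : A⟦X⟧) - 1) - ((v : A⟦X⟧) - 1) * ((u : A⟦X⟧) - 1) := by noncomm_ring
    rw [this, hu, hv, mul_sub]
    congr 1
    · rw [mul_assoc, ← mul_assoc a, ← X_pow_mul, pow_add]
      noncomm_ring
    · rw [mul_assoc, ← mul_assoc b, ← X_pow_mul, add_comm m n, pow_add]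
      noncomm_ring
  have h2 : (v : A⟦X⟧) * (u : A⟦X⟧) * ((u⁻¹ : A⟦X⟧ˣ) : A⟦X⟧) * ((v⁻¹ : A⟦X⟧ˣ) : A⟦X⟧) = 1 := by
    rw [Units.mul_inv_cancel_right, Units.mul_inv]
  rw [← mul_assoc, ← mul_assoc, ← h1, sub_mul, sub_mul, h2, commutatorElement_def,
    Units.val_mul, Units.val_mul, Units.val_mul]

theorem commutator_congruenceUnits_le (m n : ℕ) :
    ⁅congruenceUnits A m, congruenceUnits A n⁆ ≤ congruenceUnits A (m + n) := by
  rw [Subgroup.commutator_le]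
  rintro u ⟨a, ha⟩ v ⟨b, hb⟩
  exact ⟨_, commutator_sub_one_eq ha hb⟩

instance congruenceUnits_normal (n : ℕ) : (congruenceUnits A n).Normal := by
  rw [← Subgroup.commutator_top_right_le_iff, ← congruenceUnits_zero]
  exact commutator_congruenceUnits_le n 0

theorem coeff_of_sub_one_eq {n : ℕ} (hn : n ≠ 0) {u : A⟦X⟧} {a : A⟦X⟧} (h : u - 1 = X ^ n * a) :
    coeff n u = constantCoeff a := by
  rw [sub_eq_iff_eq_add.1 h, map_add, coeff_one, if_neg hn, add_zero]
  simpa using coeff_X_pow_mul a n 0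

theorem constantCoeff_eq_one {u : A⟦X⟧ˣ} (hu : u ∈ congruenceUnits A 1) :
    constantCoeff (u : A⟦X⟧) = 1 := by
  obtain ⟨a, ha⟩ := hu
  rw [sub_eq_iff_eq_add.1 ha]
  simp

/-- In positive degree the inverses have constant term $1$, so the leading term of a group
commutator is the Lie bracket of the leading terms. -/
theorem coeff_commutator {m n : ℕ} (hm : m ≠ 0) (hn : n ≠ 0) {u v : A⟦X⟧ˣ}
    (hu : u ∈ congruenceUnits A m) (hv : v ∈ congruenceUnits A n) :
    coeff (m + n) ((⁅u, v⁆ : A⟦X⟧ˣ) : A⟦X⟧) =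
      coeff m (u : A⟦X⟧) * coeff n (v : A⟦X⟧) - coeff n (v : A⟦X⟧) * coeff m (u : A⟦X⟧) := by
  have hu' := inv_mem (congruenceUnits_antitone (Nat.one_le_iff_ne_zero.2 hm) hu)
  have hv' := inv_mem (congruenceUnits_antitone (Nat.one_le_iff_ne_zero.2 hn) hv)
  obtain ⟨a, ha⟩ := hu
  obtain ⟨b, hb⟩ := hv
  rw [coeff_of_sub_one_eq (by omega) (commutator_sub_one_eq ha hb), coeff_of_sub_one_eq hm ha,
    coeff_of_sub_one_eq hn hb, map_mul, map_mul, constantCoeff_eq_one hu',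
    constantCoeff_eq_one hv', map_sub, map_mul, map_mul, mul_one, mul_one]

theorem coeff_mul_of_mem {n : ℕ} (hn : n ≠ 0) {u v : A⟦X⟧ˣ} (hu : u ∈ congruenceUnits A n)
    (hv : v ∈ congruenceUnits A n) :
    coeff n ((u * v : A⟦X⟧ˣ) : A⟦X⟧) = coeff n (u : A⟦X⟧) + coeff n (v : A⟦X⟧) := by
  have hv' := constantCoeff_eq_one (congruenceUnits_antitone (Nat.one_le_iff_ne_zero.2 hn) hv)
  obtain ⟨a, ha⟩ := hu
  obtain ⟨b, hb⟩ := hv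
  have : ((u * v : A⟦X⟧ˣ) : A⟦X⟧) - 1 = X ^ n * (a * (v : A⟦X⟧) + b) := by
    rw [mul_add, ← hb, ← mul_assoc, ← ha, Units.val_mul]
    noncomm_ring
  rw [coeff_of_sub_one_eq hn this, coeff_of_sub_one_eq hn ha, coeff_of_sub_one_eq hn hb, map_add,
    map_mul, hv', mul_one]

theorem coeff_eq_zero_of_mem {n : ℕ} (hn : n ≠ 0) {u : A⟦X⟧ˣ}
    (hu : u ∈ congruenceUnits A (n + 1)) : coeff n (u : A⟦X⟧) = 0 := by
  have := X_pow_dvd_iff.1 hu n n.lt_succ_self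
  rwa [map_sub, coeff_one, if_neg hn, sub_zero] at this

/-- The leading coefficient, as a homomorphism on the units congruent to `1` modulo `X ^ n`. -/
noncomputable def leadingCoeffHom (A : Type*) [Ring A] (n : ℕ) (hn : n ≠ 0) :
    congruenceUnits A n →* Multiplicative A :=
  MonoidHom.mk' (fun u => Multiplicative.ofAdd (coeff n ((u : A⟦X⟧ˣ) : A⟦X⟧)))
    fun u v => congrArg Multiplicative.ofAdd (coeff_mul_of_mem hn u.2 v.2)

/-- The unit `1 + a X` of `A⟦X⟧`. -/
noncomputable def oneAddUnit (a : A) : A⟦X⟧ˣ where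
  val := 1 + X * C a
  inv := invOfUnit (1 + X * C a) 1
  val_inv := mul_invOfUnit _ 1 (by simp)
  inv_val := invOfUnit_mul _ 1 (by simp)

theorem oneAddUnit_mem (a : A) : oneAddUnit a ∈ congruenceUnits A 1 :=
  ⟨C a, by simp [oneAddUnit]⟩

theorem oneAddUnit_pow_mem {a : A} {n : ℕ} (h : n • a = 0) :
    oneAddUnit a ^ n ∈ congruenceUnits A 2 := by
  -- Binomial expansion to first order.
  have h1 : ∀ k : ℕ, X ^ 2 ∣ (1 + X * C a : A⟦X⟧) ^ k - (1 + X * C (k • a)) := by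
    intro k
    induction k with
    | zero => simp
    | succ k ih =>
      have : (1 + X * C a : A⟦X⟧) ^ (k + 1) - (1 + X * C ((k + 1) • a)) =
          ((1 + X * C a : A⟦X⟧) ^ k - (1 + X * C (k • a))) * (1 + X * C a) +
            X ^ 2 * (C (k • a) * C a) := by
        have h2 : (X * C (k • a) * (X * C a) : A⟦X⟧) = X ^ 2 * (C (k • a) * C a) := by
          rw [mul_assoc, ← mul_assoc (C (k • a)), ← X_mul, pow_two]
          noncomm_ring
        rw [← h2, pow_succ, succ_nsmul a k, map_add]
        noncomm_ring
      rw [this]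
      exact dvd_add (ih.mul_right _) (dvd_mul_right _ _)
  have := h1 n
  rw [h] at this
  rw [mem_congruenceUnits, Units.val_pow_eq_pow_val]
  simpa [oneAddUnit] using this

variable {t : ℕ}

/-- The Magnus homomorphism sending `x_i` to `1 + a_i X`. -/
noncomputable def magnus (a : Fin t → A) : FreeGroup (Fin t) →* A⟦X⟧ˣ :=
  FreeGroup.lift fun i => oneAddUnit (a i)

theorem magnus_of (a : Fin t → A) (i : Fin t) : magnus a (.of i) = oneAddUnit (a i) :=
  FreeGroup.lift_apply_of

theorem magnus_mem (a : Fin t → A) (g : FreeGroup (Fin t)) : magnus a g ∈ congruenceUnits A 1 := by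
  induction g using FreeGroup.induction_on with
  | C1 => simp
  | of i => exact magnus_of a i ▸ oneAddUnit_mem _
  | inv_of i h => exact map_inv (magnus a) _ ▸ inv_mem h
  | mul x y hx hy => exact map_mul (magnus a) x y ▸ mul_mem hx hy

/-- Each commutator with the whole group raises the congruence degree by one. The start is `k = 1`
for the lower central series and `k = 2` for `powClosure r`. -/
theorem iterComm_le_comap_magnus (a : Fin t → A) {S : Subgroup (FreeGroup (Fin t))} {k : ℕ}
    (hS : S ≤ (congruenceUnits A k).comap (magnus a)) (n : ℕ) :
    iterComm S n ≤ (congruenceUnits A (k + n)).comap (magnus a) := by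
  induction n with
  | zero => exact hS
  | succ n ih =>
    refine Subgroup.commutator_le.2 fun x hx y _ => ?_
    rw [Subgroup.mem_comap, map_commutatorElement]
    exact commutator_congruenceUnits_le _ 1
      (Subgroup.commutator_mem_commutator (ih hx) (magnus_mem a y))

theorem magnus_eval (a : Fin t → A) (w : BracketWord t) :
    magnus a (eval w) ∈ congruenceUnits A w.length ∧
      coeff w.length (magnus a (eval w) : A⟦X⟧) = lieEval a w := by
  induction w with
  | of i =>
    refine ⟨magnus_mem a _, ?_⟩
    change coeff 1 ((magnus a (.of i) : A⟦X⟧ˣ) : A⟦X⟧) = a i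
    rw [magnus_of]
    have : (oneAddUnit (a i) : A⟦X⟧) - 1 = X ^ 1 * C (a i) := by simp [oneAddUnit]
    rw [coeff_of_sub_one_eq one_ne_zero this]
    simp
  | mul u v hu hv =>
    change magnus a ⁅eval u, eval v⁆ ∈ congruenceUnits A (u.length + v.length) ∧
      coeff (u.length + v.length) ((magnus a ⁅eval u, eval v⁆ : A⟦X⟧ˣ) : A⟦X⟧) = _
    rw [map_commutatorElement]
    refine ⟨commutator_congruenceUnits_le _ _
      (Subgroup.commutator_mem_commutator hu.1 hv.1), ?_⟩
    rw [coeff_commutator u.length_pos.ne' v.length_pos.ne' hu.1 hv.1, hu.2, hv.2]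
    rfl

theorem powClosure_le_comap_magnus (a : Fin t → A) (r : Fin t → ℕ) (h : ∀ i, r i • a i = 0) :
    powClosure r ≤ (congruenceUnits A 2).comap (magnus a) := by
  refine Subgroup.normalClosure_le_normal ?_
  rintro _ ⟨i, rfl⟩
  change magnus a _ ∈ congruenceUnits A 2
  rw [map_pow, magnus_of]
  exact oneAddUnit_pow_mem (h i)

end Magnus

/-! ### Commutator calculus modulo higher weight. -/

section LowerCentralSeries

variable {F : Type*} [Group F]

/-- The three subgroups lemma, modulo a normal subgroup. -/
theorem commutator_commutator_le_of_rotate {H₁ H₂ H₃ N : Subgroup F} [N.Normal]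
    (h1 : ⁅⁅H₂, H₃⁆, H₁⁆ ≤ N) (h2 : ⁅⁅H₃, H₁⁆, H₂⁆ ≤ N) : ⁅⁅H₁, H₂⁆, H₃⁆ ≤ N := by
  have key : ∀ K : Subgroup F, K ≤ N ↔ K.map (QuotientGroup.mk' N) = ⊥ := fun K => by
    rw [Subgroup.map_eq_bot_iff, QuotientGroup.ker_mk']
  simp only [key, Subgroup.map_commutator] at h1 h2 ⊢
  exact Subgroup.commutator_commutator_eq_bot_of_rotate h1 h2

/-- Three subgroups lemma, by induction on `n` for all `m`. For `S = ⊤` this is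
$[\gamma_i,\gamma_j]\le\gamma_{i+j}$. -/
theorem commutator_iterComm_lowerCentralSeries_le (S : Subgroup F) [S.Normal] (m n : ℕ) :
    ⁅iterComm S m, (⊤ : Subgroup F).lowerCentralSeries n⁆ ≤ iterComm S (m + n + 1) := by
  induction n generalizing m with
  | zero => exact le_rfl
  | succ n ih =>
    rw [Subgroup.commutator_comm]
    refine commutator_commutator_le_of_rotate ?_ ?_
    · rw [Subgroup.commutator_comm ⊤]
      have := ih (m + 1)
      rwa [show m + 1 + n + 1 = m + (n + 1) + 1 by ring] at this
    · exact Subgroup.commutator_mono (ih m) le_rfl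

theorem iterComm_top (n : ℕ) :
    iterComm (⊤ : Subgroup F) n = (⊤ : Subgroup F).lowerCentralSeries n := by
  induction n with
  | zero => rfl
  | succ n ih => rw [iterComm, ih, Subgroup.lowerCentralSeries_succ]

/-- The lower central series indexed by weight, with the whole group in weights `0` and `1`. -/
def weightLCS (F : Type*) [Group F] : ℕ → Subgroup F
  | 0 => ⊤
  | n + 1 => (⊤ : Subgroup F).lowerCentralSeries n

instance weightLCS_normal (n : ℕ) : (weightLCS F n).Normal := by
  cases n <;> unfold weightLCS <;> infer_instance

theorem weightLCS_antitone : Antitone (weightLCS F) := by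
  refine antitone_nat_of_succ_le fun n => ?_
  cases n with
  | zero => exact le_top
  | succ n => exact Subgroup.lowerCentralSeries_antitone _ n.le_succ

theorem commutator_weightLCS_le (m n : ℕ) :
    ⁅weightLCS F m, weightLCS F n⁆ ≤ weightLCS F (m + n) := by
  rcases m with _ | m
  · rw [Nat.zero_add]
    exact Subgroup.commutator_le_right _ _
  rcases n with _ | n
  · exact Subgroup.commutator_le_left _ _
  have := commutator_iterComm_lowerCentralSeries_le (⊤ : Subgroup F) m n
  rw [iterComm_top, iterComm_top] at this
  rw [show m + 1 + (n + 1) = m + n + 1 + 1 by omega]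
  exact this

theorem commutator_mem_weightLCS {m n : ℕ} {x y : F} (hx : x ∈ weightLCS F m)
    (hy : y ∈ weightLCS F n) : ⁅x, y⁆ ∈ weightLCS F (m + n) :=
  commutator_weightLCS_le m n (Subgroup.commutator_mem_commutator hx hy)

theorem normal_of_weightLCS_le {n : ℕ} {K : Subgroup F} (h1 : weightLCS F (n + 1) ≤ K)
    (h2 : K ≤ weightLCS F n) : K.Normal := by
  rw [← Subgroup.commutator_top_right_le_iff]
  exact (Subgroup.commutator_mono h2 le_rfl).trans ((commutator_weightLCS_le n 1).trans h1)

/-- The elements that commute with `z` modulo the normal subgroup `K`. -/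
def centralizerMod (K : Subgroup F) [K.Normal] (z : F) : Subgroup F :=
  (Subgroup.centralizer {(z : F ⧸ K)}).comap (QuotientGroup.mk' K)

theorem commute_mk_iff {K : Subgroup F} [K.Normal] {x z : F} :
    Commute (x : F ⧸ K) (z : F ⧸ K) ↔ ⁅x, z⁆ ∈ K := by
  rw [← commutatorElement_eq_one_iff_commute, ← QuotientGroup.eq_one_iff]
  rfl

theorem mem_centralizerMod {K : Subgroup F} [K.Normal] {x z : F} :
    x ∈ centralizerMod K z ↔ ⁅x, z⁆ ∈ K := by
  rw [← commute_mk_iff, centralizerMod, Subgroup.mem_comap, Subgroup.mem_centralizer_singleton_iff]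
  rfl

theorem commutator_mem_symm {K : Subgroup F} {x y : F} : ⁅x, y⁆ ∈ K ↔ ⁅y, x⁆ ∈ K := by
  rw [← commutatorElement_inv, inv_mem_iff]

theorem commutatorElement_pow_left_of_commute {x y : F} (h : Commute x ⁅x, y⁆) (n : ℕ) :
    ⁅x ^ n, y⁆ = ⁅x, y⁆ ^ n := by
  induction n with
  | zero => simp
  | succ n ih =>
    rw [pow_succ', commutatorElement_mul_left_eq_conj_mul, ih, pow_succ]
    congr 1
    rw [(h.pow_right n).eq, mul_inv_cancel_right]

/-- The Hall–Witt identity, read as the Jacobi identity modulo a normal subgroup. -/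
theorem commutator_commutator_mem_of_rotate {K : Subgroup F} [K.Normal] {k l m : ℕ}
    (hK : weightLCS F (k + l + m + 1) ≤ K) (hk : k ≠ 0) (hl : l ≠ 0) (hm : m ≠ 0) {x y z : F}
    (hx : x ∈ weightLCS F k) (hy : y ∈ weightLCS F l) (hz : z ∈ weightLCS F m)
    (h1 : ⁅⁅y, z⁆, x⁆ ∈ K) (h2 : ⁅⁅z, x⁆, y⁆ ∈ K) : ⁅⁅x, y⁆, z⁆ ∈ K := by
  have hxy := commutator_mem_weightLCS hx hy
  have hyz := commutator_mem_weightLCS hy hz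
  have hzx := commutator_mem_weightLCS hz hx
  -- As `k`, `l`, `m` are positive, these commutators have weight above `k + l + m`, so the
  -- conjugations in the Hall–Witt identity are harmless modulo `K`.
  have c1 : ⁅⁅y, z⁆, ⁅z, x⁆⁆ ∈ K :=
    hK (weightLCS_antitone (by omega) (commutator_mem_weightLCS hyz hzx))
  have c2 : ⁅⁅z, x⁆, ⁅x, y⁆⁆ ∈ K :=
    hK (weightLCS_antitone (by omega) (commutator_mem_weightLCS hzx hxy))
  have c3 : ⁅⁅x, y⁆, ⁅y, z⁆⁆ ∈ K :=
    hK (weightLCS_antitone (by omega) (commutator_mem_weightLCS hxy hyz))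
  have conj_eq : ∀ a b : F, a * b * a⁻¹ = ⁅a, b⁆ * b := fun a b => by
    rw [commutatorElement_def]
    group
  have e1 : ⁅⁅y, z⁆, z * x * z⁻¹⁆ ∈ K := by
    rw [conj_eq, commutator_mem_symm]
    rw [commutator_mem_symm] at c1 h1
    exact mem_centralizerMod.1 (mul_mem (mem_centralizerMod.2 c1) (mem_centralizerMod.2 h1))
  have e2 : ⁅⁅z, x⁆, x * y * x⁻¹⁆ ∈ K := by
    rw [conj_eq, commutator_mem_symm]
    rw [commutator_mem_symm] at c2 h2
    exact mem_centralizerMod.1 (mul_mem (mem_centralizerMod.2 c2) (mem_centralizerMod.2 h2))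
  have hw : ⁅⁅x, y⁆, y * z * y⁻¹⁆ = (⁅⁅y, z⁆, z * x * z⁻¹⁆ * ⁅⁅z, x⁆, x * y * x⁻¹⁆)⁻¹ := by
    simp only [commutatorElement_def]
    group
  have e3 : ⁅⁅x, y⁆, y * z * y⁻¹⁆ ∈ K := hw ▸ inv_mem (mul_mem e1 e2)
  rw [conj_eq, commutator_mem_symm] at e3
  rw [commutator_mem_symm] at c3 ⊢
  exact mem_centralizerMod.1 ((Subgroup.mul_mem_cancel_left _ (mem_centralizerMod.2 c3)).1
    (mem_centralizerMod.2 e3))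

/-- If `x ^ k` is trivial modulo `[S, F, ..., F]` and the next term of the lower central series,
then so is `⁅x, y⁆ ^ k`. -/
theorem commutator_pow_mem (S : Subgroup F) [S.Normal] {m n k : ℕ} {x y : F}
    (hx : x ∈ weightLCS F (m + 1)) (hy : y ∈ weightLCS F (n + 1))
    (h : x ^ k ∈ iterComm S m ⊔ weightLCS F (m + 2)) :
    ⁅x, y⁆ ^ k ∈ iterComm S (m + n + 1) ⊔ weightLCS F (m + n + 3) := by
  set K := iterComm S (m + n + 1) ⊔ weightLCS F (m + n + 3)
  -- The weight `2(m + 1) + (n + 1)` is at least `m + n + 3`; so `x` commutes with `⁅x, y⁆` modulo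
  -- `K`, and $[x^k,y]\equiv[x,y]^k$.
  have hc : ⁅x, ⁅x, y⁆⁆ ∈ K := (le_sup_right : _ ≤ K) (weightLCS_antitone (by omega)
    (commutator_mem_weightLCS hx (commutator_mem_weightLCS hx hy)))
  have hpow : ⁅x ^ k, y⁆ ∈ K := by
    refine mem_centralizerMod.1 ((sup_le ?_ ?_ : _ ≤ centralizerMod K y) h)
    · exact fun s hs => mem_centralizerMod.2 ((le_sup_left : _ ≤ K)
        (commutator_iterComm_lowerCentralSeries_le S m n
          (Subgroup.commutator_mem_commutator hs hy)))
    · exact fun s hs => mem_centralizerMod.2 ((le_sup_right : _ ≤ K)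
        (weightLCS_antitone (by omega) (commutator_mem_weightLCS hs hy)))
  rw [← QuotientGroup.eq_one_iff] at hpow ⊢
  rw [← commute_mk_iff] at hc
  exact (commutatorElement_pow_left_of_commute (x := (x : F ⧸ K)) (y := (y : F ⧸ K)) hc k).symm.trans
    hpow

end LowerCentralSeries

/-! ### Hall's rewriting: generation by basic commutators. -/

section HallRewriting

variable {t : ℕ}

theorem eval_mem_weightLCS (w : BracketWord t) : eval w ∈ weightLCS _ w.length := by
  induction w with
  | of i => exact Subgroup.mem_top _
  | mul u v hu hv => exact commutator_mem_weightLCS hu hv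

/-- The letters that occur in a bracketed word. -/
def letters : BracketWord t → Finset (Fin t)
  | .of i => {i}
  | .mul u v => letters u ∪ letters v

/-- One occurrence of the letter suffices: $x_i^{r_i}\in S$ at that leaf, and each enclosing bracket
carries the power along. -/
theorem eval_pow_mem (r : Fin t → ℕ) (w : BracketWord t) {i : Fin t} (hi : i ∈ letters w) :
    eval w ^ r i ∈ iterComm (powClosure r) (w.length - 1) ⊔ weightLCS _ (w.length + 1) := by
  induction w with
  | of j =>
    obtain rfl := Finset.mem_singleton.1 hi
    exact (le_sup_left : iterComm (powClosure r) 0 ≤ _)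
      (Subgroup.subset_normalClosure ⟨i, rfl⟩)
  | mul u v hu hv =>
    obtain ⟨m, hm⟩ : ∃ m, u.length = m + 1 := ⟨_, (Nat.succ_pred_eq_of_pos u.length_pos).symm⟩
    obtain ⟨n, hn⟩ : ∃ n, v.length = n + 1 := ⟨_, (Nat.succ_pred_eq_of_pos v.length_pos).symm⟩
    have hum := eval_mem_weightLCS u
    have hvm := eval_mem_weightLCS v
    change ⁅eval u, eval v⁆ ^ r i ∈ iterComm (powClosure r) (u.length + v.length - 1) ⊔
      weightLCS _ (u.length + v.length + 1)
    rw [hm] at hu hum ⊢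
    rw [hn] at hv hvm ⊢
    rw [show m + 1 + (n + 1) - 1 = m + n + 1 by omega,
      show m + 1 + (n + 1) + 1 = m + n + 3 by omega]
    rcases Finset.mem_union.1 hi with h | h
    · exact commutator_pow_mem _ hum hvm (hu h)
    · rw [← commutatorElement_inv, inv_pow, inv_mem_iff, add_comm m n]
      exact commutator_pow_mem _ hvm hum (hv h)

/-- The subgroup generated by the values of the basic commutators of weight `n`, together with the
lower central series term of weight `n + 1`. -/
def basicSubgroup (lt : BracketWord t → BracketWord t → Prop) (n : ℕ) :
    Subgroup (FreeGroup (Fin t)) :=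
  Subgroup.closure {g | ∃ w, IsBasic lt w ∧ w.length = n ∧ eval w = g} ⊔ weightLCS _ (n + 1)

variable {lt : BracketWord t → BracketWord t → Prop}

theorem weightLCS_le_basicSubgroup {m n : ℕ} (h : n + 1 ≤ m) :
    weightLCS _ m ≤ basicSubgroup lt n :=
  (weightLCS_antitone h).trans le_sup_right

theorem basicSubgroup_le (n : ℕ) : basicSubgroup lt n ≤ weightLCS _ n := by
  refine sup_le ((Subgroup.closure_le _).2 ?_) (weightLCS_antitone n.le_succ)
  rintro _ ⟨w, _, rfl, rfl⟩
  exact eval_mem_weightLCS w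

instance basicSubgroup_normal (n : ℕ) : (basicSubgroup lt n).Normal :=
  normal_of_weightLCS_le le_sup_right (basicSubgroup_le n)

theorem eval_mem_basicSubgroup {w : BracketWord t} (hw : IsBasic lt w) :
    eval w ∈ basicSubgroup lt w.length :=
  (le_sup_left : _ ≤ basicSubgroup lt w.length) (Subgroup.subset_closure ⟨w, hw, rfl, rfl⟩)

/-- The elements commuting with `z` modulo `basicSubgroup lt N` form a subgroup, so it is enough to
test generators. -/
theorem commutator_mem_basicSubgroup {m n N : ℕ} (hN : m + n = N) {x z : FreeGroup (Fin t)}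
    (hx : x ∈ basicSubgroup lt m) (hz : z ∈ weightLCS _ n)
    (h : ∀ w, IsBasic lt w → w.length = m → ⁅eval w, z⁆ ∈ basicSubgroup lt N) :
    ⁅x, z⁆ ∈ basicSubgroup lt N := by
  refine mem_centralizerMod.1 ((sup_le ?_ ?_ : _ ≤ centralizerMod (basicSubgroup lt N) z) hx)
  · rw [Subgroup.closure_le]
    rintro _ ⟨w, hw, hm, rfl⟩
    exact mem_centralizerMod.2 (h w hw hm)
  · exact fun s hs => mem_centralizerMod.2
      (weightLCS_le_basicSubgroup (by omega) (commutator_mem_weightLCS hs hz))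

/-- Hall's rewriting: the commutator of two basic commutators is a product of basic commutators,
modulo the next term of the lower central series. -/
theorem commutator_eval_mem_basicSubgroup (hlt : IsCommutatorOrder lt) (N : ℕ) :
    ∀ u v, IsBasic lt u → IsBasic lt v → u.length + v.length = N →
      ⁅eval u, eval v⁆ ∈ basicSubgroup lt N := by
  induction N using Nat.strong_induction_on with
  | h N ihN =>
  have := hlt.isStrictTotalOrder
  have aux : ∀ v ∈ {w : BracketWord t | w.length ≤ N}, ∀ u, IsBasic lt u → IsBasic lt v → lt v u →
      u.length + v.length = N → ⁅eval u, eval v⁆ ∈ basicSubgroup lt N := by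
    intro v hv
    have hst : IsStrictOrder (BracketWord t) (Function.swap lt) :=
      { irrefl := hlt.irrefl, trans := fun a b c hab hbc => hlt.trans _ _ _ hbc hab }
    -- Within total weight `N`, downward induction on the smaller entry `v`; it is well founded
    -- since only finitely many words have weight at most `N`.
    refine ((finite_length_le t N).wellFoundedOn (r := Function.swap lt)).induction
      (P := fun v => ∀ u, IsBasic lt u → IsBasic lt v → lt v u →
        u.length + v.length = N → ⁅eval u, eval v⁆ ∈ basicSubgroup lt N) hv
      fun v hv ih u hu hvb hvu hN => ?_
    have ih' : ∀ p q, IsBasic lt p → IsBasic lt q → lt v p → lt v q → p.length + q.length = N →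
        ⁅eval p, eval q⁆ ∈ basicSubgroup lt N := by
      intro p q hp hq hvp hvq hpq
      rcases hlt.total p q with h | rfl | h
      · rw [commutator_mem_symm]
        exact ih p (show p.length ≤ N by omega) hvp q hq hp h (by omega)
      · rw [commutatorElement_self]
        exact one_mem _
      · exact ih q (show q.length ≤ N by omega) hvq p hp hq h hpq
    by_cases hb : IsBasic lt (u * v)
    · have := eval_mem_basicSubgroup hb
      change ⁅eval u, eval v⁆ ∈ basicSubgroup lt (u.length + v.length) at this
      rwa [hN] at this
    · have : ∃ a b, u = a * b ∧ lt v b := by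
        by_contra! hcon
        refine hb ⟨hu, hvb, hvu, fun a b hab => ?_⟩
        rcases hlt.total b v with h | h | h
        · exact Or.inr h
        · exact Or.inl h
        · exact absurd h (hcon a b hab)
      obtain ⟨a, b, rfl, hvb'⟩ := this
      obtain ⟨ha, hbb, hba, -⟩ := hu
      have hva := hlt.trans _ _ _ hvb' hba
      have hN : a.length + b.length + v.length = N := hN
      have la := a.length_pos
      have lb := b.length_pos
      have lv := v.length_pos
      -- By Jacobi, `[[a, b], v]` reduces to `[[b, v], a]` and `[[v, a], b]`. The inner brackets
      -- expand into basic `w` of smaller total weight than `N`; `w` outweighs `v`, and `a > b > v`,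
      -- so both entries of `[w, a]` and `[w, b]` exceed `v`.
      refine commutator_commutator_mem_of_rotate (k := a.length) (l := b.length) (m := v.length)
        (weightLCS_le_basicSubgroup (by omega)) la.ne' lb.ne' lv.ne' (eval_mem_weightLCS a)
        (eval_mem_weightLCS b) (eval_mem_weightLCS v) ?_ ?_
      · exact commutator_mem_basicSubgroup (n := a.length) (by omega)
          (ihN (b.length + v.length) (by omega) b v hbb hvb rfl) (eval_mem_weightLCS a)
          fun w hw hwl => ih' w a hw ha (hlt.weight _ _ (by omega)) hva (by omega)
      · exact commutator_mem_basicSubgroup (n := b.length) (by omega)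
          (ihN (v.length + a.length) (by omega) v a hvb ha rfl) (eval_mem_weightLCS b)
          fun w hw hwl => ih' w b hw hbb (hlt.weight _ _ (by omega)) hvb' (by omega)
  intro u v hu hv hN
  rcases hlt.total u v with h | rfl | h
  · rw [commutator_mem_symm]
    exact aux u (show u.length ≤ N by omega) v hv hu h (by omega)
  · rw [commutatorElement_self]
    exact one_mem _
  · exact aux v (show v.length ≤ N by omega) u hu hv h hN

theorem weightLCS_succ_eq_basicSubgroup (hlt : IsCommutatorOrder lt) (n : ℕ) :
    weightLCS _ (n + 1) = basicSubgroup lt (n + 1) := by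
  have h1 : weightLCS _ 1 ≤ basicSubgroup lt 1 := by
    refine le_trans ?_ le_sup_left
    change ⊤ ≤ _
    rw [← FreeGroup.closure_range_of]
    refine Subgroup.closure_mono ?_
    rintro _ ⟨i, rfl⟩
    exact ⟨.of i, trivial, rfl, rfl⟩
  refine le_antisymm ?_ (basicSubgroup_le _)
  induction n with
  | zero => exact h1
  | succ n ih =>
    refine Subgroup.commutator_le.2 fun x hx g _ => ?_
    have hg : g ∈ weightLCS _ 1 := Subgroup.mem_top g
    refine commutator_mem_basicSubgroup (m := n + 1) (n := 1) rfl (ih hx) hg fun w hw hwl => ?_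
    rw [commutator_mem_symm]
    refine commutator_mem_basicSubgroup (m := 1) (n := n + 1) (by omega) (h1 hg)
      (hwl ▸ eval_mem_weightLCS w) fun v hv hvl => ?_
    exact commutator_eval_mem_basicSubgroup hlt _ v w hv hw (by omega)

end HallRewriting

/-! ### The cyclic groups attached to bracketed words. -/

section TensorGroup

variable {t : ℕ} (r : Fin t → ℕ)

theorem mem_zmultiples_tmul {M N : Type*} [AddCommGroup M] [AddCommGroup N] [Module ℤ M]
    [Module ℤ N] {a : M} {b : N} (ha : ∀ x : M, x ∈ AddSubgroup.zmultiples a)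
    (hb : ∀ x : N, x ∈ AddSubgroup.zmultiples b) (x : M ⊗[ℤ] N) :
    x ∈ AddSubgroup.zmultiples (a ⊗ₜ[ℤ] b) := by
  induction x using TensorProduct.induction_on with
  | zero => exact zero_mem _
  | add p q hp hq => exact add_mem hp hq
  | tmul p q =>
    have h1 : p ⊗ₜ[ℤ] q ∈ AddSubgroup.zmultiples (a ⊗ₜ[ℤ] q) := by
      have := AddSubgroup.mem_map_of_mem
        (AddMonoidHom.mk' (fun y : M => y ⊗ₜ[ℤ] q) fun _ _ => TensorProduct.add_tmul _ _ _) (ha p)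
      rwa [AddMonoidHom.map_zmultiples] at this
    have h2 : a ⊗ₜ[ℤ] q ∈ AddSubgroup.zmultiples (a ⊗ₜ[ℤ] b) := by
      have := AddSubgroup.mem_map_of_mem
        (AddMonoidHom.mk' (fun y : N => a ⊗ₜ[ℤ] y) fun _ _ => TensorProduct.tmul_add _ _ _) (hb q)
      rwa [AddMonoidHom.map_zmultiples] at this
    exact AddSubgroup.zmultiples_le_of_mem h2 h1

theorem nsmul_tmul_eq_zero {M N : Type*} [AddCommGroup M] [AddCommGroup N] [Module ℤ M]
    [Module ℤ N] {a : M} {b : N} {k : ℕ} (h : k • a = 0 ∨ k • b = 0) :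
    k • (a ⊗ₜ[ℤ] b) = 0 := by
  rcases h with h | h
  · rw [TensorProduct.smul_tmul', h, TensorProduct.zero_tmul]
  · rw [← TensorProduct.tmul_smul, h, TensorProduct.tmul_zero]

theorem exists_addMonoidHom_tmul {M N : Type*} [AddCommGroup M] [AddCommGroup N] [Module ℤ M]
    [Module ℤ N] {a : M} {b : N} {A : Type*} [Ring A] (ha : ∃ f : M →+ A, f a = 1)
    (hb : ∃ f : N →+ A, f b = 1) : ∃ f : M ⊗[ℤ] N →+ A, f (a ⊗ₜ[ℤ] b) = 1 := by
  obtain ⟨f, hf⟩ := ha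
  obtain ⟨g, hg⟩ := hb
  refine ⟨TensorProduct.liftAddHom ((AddMonoidHom.mul.comp f).compl₂ g) fun n x y => ?_, ?_⟩
  -- The ℤ-module structures on `M` and `N` are arbitrary instances, so compatibility with scalars
  -- comes from additivity.
  · have h1 := map_intCast_smul f ℤ ℤ n x
    have h2 := map_intCast_smul g ℤ ℤ n y
    rw [Int.cast_id] at h1 h2
    exact (congrArg (· * g y) h1).trans ((smul_mul_assoc n _ _).trans
      ((mul_smul_comm n _ _).symm.trans (congrArg (f x * ·) h2.symm)))
  · change f a * g b = 1
    rw [hf, hg, mul_one]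

theorem mem_zmultiples_elemTensor (w : BracketWord t) (h : tensorGroup r w) :
    h ∈ AddSubgroup.zmultiples (elemTensor r w) := by
  induction w with
  | of i =>
    obtain ⟨n, hn⟩ := ZMod.intCast_surjective (n := r i) h
    exact ⟨n, (zsmul_one (R := ZMod (r i)) n).trans hn⟩
  | mul u v hu hv => exact mem_zmultiples_tmul hu hv h

theorem nsmul_elemTensor_eq_zero (w : BracketWord t) {i : Fin t} (hi : i ∈ letters w) :
    r i • elemTensor r w = 0 := by
  induction w with
  | of j =>
    obtain rfl := Finset.mem_singleton.1 hi
    exact (nsmul_one (A := ZMod (r i)) _).trans (ZMod.natCast_self _)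
  | mul u v hu hv => exact nsmul_tmul_eq_zero ((Finset.mem_union.1 hi).imp hu hv)

/-- The reductions $\mathbb Z/r_i\to\mathbb Z/d$ are multiplied together along the word. -/
theorem exists_addMonoidHom_zmod (d : ℕ) (w : BracketWord t) (h : ∀ i ∈ letters w, d ∣ r i) :
    ∃ f : tensorGroup r w →+ ZMod d, f (elemTensor r w) = 1 := by
  induction w with
  | of i =>
    let f := ZMod.castHom (h i (Finset.mem_singleton_self i)) (ZMod d)
    exact ⟨f.toAddMonoidHom, map_one f⟩
  | mul u v hu hv =>
    exact exists_addMonoidHom_tmul (hu fun i hi => h i (Finset.mem_union_left _ hi))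
      (hv fun i hi => h i (Finset.mem_union_right _ hi))

/-- The order of the elementary tensor of a bracketed word. -/
def wordOrder (w : BracketWord t) : ℕ := (letters w).gcd r

theorem nsmul_eq_zero_of_letters {B : Type*} [AddMonoid B] {w : BracketWord t} {y : B}
    (hy : ∀ i ∈ letters w, r i • y = 0) : wordOrder r w • y = 0 :=
  addOrderOf_dvd_iff_nsmul_eq_zero.1
    (Finset.dvd_gcd fun i hi => addOrderOf_dvd_iff_nsmul_eq_zero.2 (hy i hi))

/-- The map factors through $\mathbb Z/d_w$, with $d_w$ the gcd, since `y` is killed by $d_w$. If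
$d_w=0$ this is $\mathbb Z$. -/
theorem exists_addMonoidHom_tensorGroup {B : Type*} [AddGroup B] (w : BracketWord t) {y : B}
    (hy : ∀ i ∈ letters w, r i • y = 0) :
    ∃ f : tensorGroup r w →+ B, f (elemTensor r w) = y := by
  obtain ⟨f, hf⟩ := exists_addMonoidHom_zmod r (wordOrder r w) w fun i hi => Finset.gcd_dvd hi
  let g := ZMod.lift (wordOrder r w) ⟨zmultiplesHom B y, by
    simpa using nsmul_eq_zero_of_letters r hy⟩
  refine ⟨g.comp f, ?_⟩
  change g (f (elemTensor r w)) = y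
  rw [hf, ← Int.cast_one, ZMod.lift_coe]
  simp

end TensorGroup

/-! ### Generators and relations of the quotient. -/

section LCSQuotient

variable {t : ℕ} (r : Fin t → ℕ) (c : ℕ)

theorem LCSQuotient.mul_comm (x y : LCSQuotient r c) : x * y = y * x := by
  obtain ⟨x, rfl⟩ := QuotientGroup.mk_surjective x
  obtain ⟨y, rfl⟩ := QuotientGroup.mk_surjective y
  refine commute_mk_iff.2 (Subgroup.mem_subgroupOf.2 (Subgroup.mem_sup_right ?_))
  exact Subgroup.commutator_mono le_rfl le_top (Subgroup.commutator_mem_commutator x.2 y.2)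

instance : CommGroup (LCSQuotient r c) :=
  { (inferInstance : Group (LCSQuotient r c)) with mul_comm := LCSQuotient.mul_comm r c }

variable {r c} {lt : BracketWord t → BracketWord t → Prop}

theorem eval_mem_lowerCentralSeries (w : BasicOfWeight lt (c + 1)) :
    eval w.1 ∈ (⊤ : Subgroup (FreeGroup (Fin t))).lowerCentralSeries c := by
  have := eval_mem_weightLCS w.1
  rwa [w.2.2] at this

variable (r) in
/-- The class of the value of a basic commutator. -/
def basicClass (w : BasicOfWeight lt (c + 1)) : LCSQuotient r c :=
  QuotientGroup.mk ⟨eval w.1, eval_mem_lowerCentralSeries w⟩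

theorem basicClass_pow (w : BasicOfWeight lt (c + 1)) {i : Fin t} (hi : i ∈ letters w.1) :
    basicClass r w ^ r i = 1 := by
  have h := eval_pow_mem r w.1 hi
  rw [w.2.2] at h
  exact (QuotientGroup.eq_one_iff (_ ^ r i)).2 (Subgroup.mem_subgroupOf.2 h)

theorem closure_basicClass (hlt : IsCommutatorOrder lt) :
    Subgroup.closure (Set.range (basicClass r : BasicOfWeight lt (c + 1) → _)) = ⊤ := by
  refine eq_top_iff.2 fun x _ => ?_
  obtain ⟨⟨x, hx⟩, rfl⟩ := QuotientGroup.mk_surjective x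
  set K := Subgroup.closure (Set.range (basicClass r : BasicOfWeight lt (c + 1) → _))
  have hle : basicSubgroup lt (c + 1) ≤ (K.comap (QuotientGroup.mk' _)).map
      ((⊤ : Subgroup (FreeGroup (Fin t))).lowerCentralSeries c).subtype := by
    refine sup_le ((Subgroup.closure_le _).2 ?_) fun y hy => ?_
    · rintro _ ⟨w, hw, hwl, rfl⟩
      exact ⟨⟨eval w, eval_mem_lowerCentralSeries ⟨w, hw, hwl⟩⟩,
        Subgroup.subset_closure ⟨⟨w, hw, hwl⟩, rfl⟩, rfl⟩
    · refine ⟨⟨y, Subgroup.lowerCentralSeries_antitone _ c.le_succ hy⟩, ?_, rfl⟩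
      have : (QuotientGroup.mk ⟨y, Subgroup.lowerCentralSeries_antitone _ c.le_succ hy⟩ :
          LCSQuotient r c) = 1 :=
        (QuotientGroup.eq_one_iff _).2 (Subgroup.mem_subgroupOf.2 (Subgroup.mem_sup_right hy))
      change (QuotientGroup.mk _ : LCSQuotient r c) ∈ K
      rw [this]
      exact one_mem _
  rw [← weightLCS_succ_eq_basicSubgroup hlt] at hle
  obtain ⟨y, hy, rfl⟩ := hle hx
  exact hy

/-- The leading term of the Magnus homomorphism, on `γ_{c+1}(F) / (ρ_{c+1}(S) γ_{c+2}(F))`. -/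
theorem exists_magnus_leading {A : Type*} [Ring A] (a : Fin t → A) (h : ∀ i, r i • a i = 0) :
    ∃ f : LCSQuotient r c →* Multiplicative A, ∀ w : BasicOfWeight lt (c + 1),
      f (basicClass r w) = Multiplicative.ofAdd (lieEval a w.1) := by
  have hlcs : ∀ n, (⊤ : Subgroup (FreeGroup (Fin t))).lowerCentralSeries n ≤
      (congruenceUnits A (n + 1)).comap (magnus a) := fun n => by
    rw [← iterComm_top, add_comm]
    exact iterComm_le_comap_magnus a (fun g _ => magnus_mem a g) n
  let m : ↥((⊤ : Subgroup (FreeGroup (Fin t))).lowerCentralSeries c) →* congruenceUnits A (c + 1) :=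
    ((magnus a).comp (Subgroup.subtype _)).codRestrict _ fun x => hlcs c x.2
  refine ⟨QuotientGroup.lift _ ((leadingCoeffHom A (c + 1) c.succ_ne_zero).comp m) ?_,
    fun w => ?_⟩
  · intro x hx
    -- Since `powClosure r` starts in degree `2`, its `c`-fold commutator reaches degree `c + 2`,
    -- just beyond the coefficient read off.
    have hle : iterComm (powClosure r) c ⊔
        (⊤ : Subgroup (FreeGroup (Fin t))).lowerCentralSeries (c + 1) ≤
          (congruenceUnits A (c + 2)).comap (magnus a) := by
      refine sup_le ?_ (hlcs (c + 1))
      rw [add_comm c 2]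
      exact iterComm_le_comap_magnus a (powClosure_le_comap_magnus a r h) c
    have := coeff_eq_zero_of_mem c.succ_ne_zero (hle (Subgroup.mem_subgroupOf.1 hx))
    exact congrArg Multiplicative.ofAdd this
  · have := (magnus_eval a w.1).2
    rw [w.2.2] at this
    exact congrArg Multiplicative.ofAdd this

theorem lieEval_ite_mem {A : Type*} [Ring A] (a : Fin t → A) (s : Finset (Fin t))
    (w : BracketWord t) :
    lieEval (fun i => if i ∈ s then a i else 0) w = if letters w ⊆ s then lieEval a w else 0 := by
  induction w with
  | of i => simp [lieEval, letters]
  | mul u v hu hv =>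
    simp only [lieEval, letters, hu, hv, Finset.union_subset_iff, ite_and, Ring.lie_def]
    split_ifs <;> simp

/-- Setting the letters outside `w₀` to zero makes `r i • a i = 0` hold for every `i` over $\mathbb
Z/d_{w_0}$. Words with other letters vanish, and independence of the rest annihilates the
coefficient of `w₀`. -/
theorem wordOrder_dvd_of_prod_eq_one (hlt : IsCommutatorOrder lt)
    [Fintype (BasicOfWeight lt (c + 1))] (n : BasicOfWeight lt (c + 1) → ℤ)
    (h : ∏ w, basicClass r w ^ n w = 1) (w₀ : BasicOfWeight lt (c + 1)) :
    (wordOrder r w₀.1 : ℤ) ∣ n w₀ := by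
  let R := ZMod (wordOrder r w₀.1)
  let a : Fin t → FreeAlgebra R (Fin t) :=
    fun i => if i ∈ letters w₀.1 then FreeAlgebra.ι R i else 0
  have ha : ∀ i, r i • a i = 0 := fun i => by
    by_cases hi : i ∈ letters w₀.1
    · have : ((r i : ℕ) : R) = 0 := (ZMod.natCast_eq_zero_iff _ _).2 (Finset.gcd_dvd hi)
      rw [← Nat.cast_smul_eq_nsmul R, this, zero_smul]
    · simp [a, hi]
  obtain ⟨f, hf⟩ := exists_magnus_leading (c := c) (lt := lt) a ha
  have h1 := congrArg (fun x => (f x).toAdd) h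
  simp only [map_prod, map_zpow, hf, toAdd_prod, toAdd_zpow, toAdd_ofAdd, map_one, toAdd_one,
    a, lieEval_ite_mem] at h1
  have h2 : ∑ w : BasicOfWeight lt (c + 1), (if letters w.1 ⊆ letters w₀.1 then (n w : R) else 0) •
      lieEval (FreeAlgebra.ι R) w.1 = 0 := by
    rw [← h1]
    refine Finset.sum_congr rfl fun w _ => ?_
    split_ifs
    · rw [Int.cast_smul_eq_zsmul]
    · rw [zero_smul, smul_zero]
  have h3 := Fintype.linearIndependent_iff.1 (linearIndependent_lieEval R hlt (c + 1)) _ h2 w₀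
  rw [if_pos subset_rfl] at h3
  exact (ZMod.intCast_zmod_eq_zero_iff_dvd _ _).1 h3

end LCSQuotient

theorem finite_basicOfWeight {t : ℕ} (lt : BracketWord t → BracketWord t → Prop) (n : ℕ) :
    Finite (BasicOfWeight lt n) :=
  ((finite_length_le t n).subset fun _ hw => hw.2.le : {w | IsBasic lt w ∧ w.length = n}.Finite)

end BasicComm

/-! ### The isomorphism. -/

open BasicComm in
theorem theorem2p2 (t : ℕ) (r : Fin t → ℕ) (c : ℕ) (hc : 1 ≤ c)
    (lt : BasicComm.BracketWord t → BasicComm.BracketWord t → Prop)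
    (hlt : BasicComm.IsCommutatorOrder lt) :
    ∃ e : BasicComm.LCSQuotient r c ≃* Multiplicative (BasicComm.T r lt (c + 1)),
      ∀ w : BasicComm.BasicOfWeight lt (c + 1),
        ∃ hw : BasicComm.eval w.1 ∈ (⊤ : Subgroup (FreeGroup (Fin t))).lowerCentralSeries c,
          e (QuotientGroup.mk ⟨BasicComm.eval w.1, hw⟩) =
            Multiplicative.ofAdd
              (DirectSum.of (fun w : BasicComm.BasicOfWeight lt (c + 1) =>
                (BasicComm.tensorGroup r w.1 : Type)) w (BasicComm.elemTensor r w.1)) := by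
  have := finite_basicOfWeight lt (c + 1)
  have := Fintype.ofFinite (BasicOfWeight lt (c + 1))
  have hex : ∀ w : BasicOfWeight lt (c + 1), ∃ f : tensorGroup r w.1 →+ Additive (LCSQuotient r c),
      f (elemTensor r w.1) = Additive.ofMul (basicClass r w) := fun w =>
    exists_addMonoidHom_tensorGroup r w.1 fun i hi =>
      congrArg Additive.ofMul (basicClass_pow w hi)
  choose f hf using hex
  let Ψ : T r lt (c + 1) →+ Additive (LCSQuotient r c) := DirectSum.toAddMonoid f
  have hΨ : ∀ w, Ψ (DirectSum.of (fun w : BasicOfWeight lt (c + 1) =>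
      (tensorGroup r w.1 : Type)) w (elemTensor r w.1)) = Additive.ofMul (basicClass r w) :=
    fun w => (DirectSum.toAddMonoid_of f w _).trans (hf w)
  have hinj : Function.Injective Ψ := by
    rw [injective_iff_map_eq_zero]
    intro z hz
    -- Each component of `z` is an integer multiple of its elementary tensor, so `Ψ z = 0` becomes a
    -- relation among basic classes.
    choose n hn using fun w : BasicOfWeight lt (c + 1) => AddSubgroup.mem_zmultiples_iff.1 (mem_zmultiples_elemTensor r w.1 (z w))
    have hzsum : z = ∑ w, n w • DirectSum.of (fun w : BasicOfWeight lt (c + 1) =>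
        (tensorGroup r w.1 : Type)) w (elemTensor r w.1) := by
      rw [← DirectSum.sum_univ_of z]
      refine Finset.sum_congr rfl fun w _ => ?_
      rw [← hn w, map_zsmul]
    have hprod : ∏ w, basicClass r w ^ n w = 1 := by
      rw [hzsum, map_sum] at hz
      simp only [map_zsmul, hΨ] at hz
      exact hz
    rw [hzsum]
    refine Finset.sum_eq_zero fun w _ => ?_
    obtain ⟨k, hk⟩ := wordOrder_dvd_of_prod_eq_one hlt n hprod w
    rw [hk, ← map_zsmul, mul_comm, mul_smul, natCast_zsmul,
      nsmul_eq_zero_of_letters r fun i hi => nsmul_elemTensor_eq_zero r w.1 hi]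
    simp
  have hsurj : Function.Surjective Ψ := by
    suffices h : ∀ y ∈ Subgroup.closure (Set.range (basicClass r : BasicOfWeight lt (c + 1) → _)),
        ∃ z, Ψ z = Additive.ofMul y from
      fun x => h x.toMul (closure_basicClass (r := r) (c := c) hlt ▸ Subgroup.mem_top _)
    intro y hx
    induction hx using Subgroup.closure_induction with
    | mem y hy =>
      obtain ⟨w, rfl⟩ := hy
      exact ⟨_, hΨ w⟩
    | one => exact ⟨0, map_zero Ψ⟩
    | mul y z _ _ hy hz =>
      obtain ⟨p, hp⟩ := hy
      obtain ⟨q, hq⟩ := hz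
      exact ⟨p + q, by rw [map_add, hp, hq]; rfl⟩
    | inv y _ hy =>
      obtain ⟨p, hp⟩ := hy
      exact ⟨-p, by rw [map_neg, hp]; rfl⟩
  let e := AddEquiv.ofBijective Ψ ⟨hinj, hsurj⟩
  refine ⟨AddEquiv.toMultiplicativeRight e.symm, fun w => ⟨eval_mem_lowerCentralSeries w, ?_⟩⟩
  exact congrArg Multiplicative.ofAdd (e.symm_apply_eq.2 (hΨ w).symm)
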